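/- Theorem (parabolic maximum principle). Let $(X,d)$ be a separable, locally compact metric space, $\mu$ a positive Radon measure on $X$, and $(\mathcal{E},\mathbb{D})$ a symmetric, regular, strictly local Dirichlet form on $L^2(X,\mu)$. Regard $\mathbb{D}$ as a Hilbert space with inner product $\mathcal{E}_1(f,g)=\mathcal{E}(f,g)+\int_X fg\,d\mu$, and use the Gelfand triple $\mathbb{D}\subset L^2(X,\mu)\subset\mathbb{D}^*$. For $U\subset X$ open let $\mathbb{D}(U)$ be the $\mathcal{E}_1$-closure of $\mathbb{D}\cap C_c(U)$. For $0<T<\infty$ let $W^{1,2}([0,T];\mathbb{D},\mathbb{D}^*)$ be the space of $u\in L^2([0,T];\mathbb{D})$ that have a weak time derivative $u'\in L^2([0,T];\mathbb{D}^*)$; every such $u$ has a unique representative in $C([0,T];L^2(X,\mu))$, and $u(0)$ denotes the value of that representative at $0$. Let $U\subset X$ be open and suppose that $u\in W^{1,2}([0,T];\mathbb{D},\mathbb{D}^*)$ satisfies: 1. $u(0)\le 0$ $\mu$-a.e. on $X$; 2. $u(t)^+\in\mathbb{D}(U)$ for a.e. $t\in[0,T]$; 3. for every $\phi\in L^2([0,T];\mathbb{D}(U))$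 that vanishes outside $(\delta,T-\delta)$ for some $\delta>0$, $$\int_0^T\big[(u'(t),\phi(t))_{\mathbb{D}^*,\mathbb{D}}+\mathcal{E}(u(t),\phi(t))\big]\,dt=0.$$ Then $u\le 0$ a.e. on $[0,T]\times U$. -/

import Mathlib

open MeasureTheory Set Filter Topology
open scoped ENNReal ContDiff

/-- A symmetric Dirichlet form on the real Hilbert space `L²(X, μ)`: a nonnegative symmetric
bilinear form on a dense subspace of `L²(X, μ)` which is closed and Markovian. -/
structure DirichletForm {X : Type*} [MeasurableSpace X] (μ : Measure X) where
  /-- the domain `𝔻` -/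
  domain : Submodule ℝ (Lp ℝ 2 μ)
  /-- the form `ℰ` -/
  form : domain →ₗ[ℝ] domain →ₗ[ℝ] ℝ
  dense_domain : Dense (domain : Set (Lp ℝ 2 μ))
  symm : ∀ f g, form f g = form g f
  nonneg : ∀ f, 0 ≤ form f f
  /-- Closedness: `𝔻` is complete for `ℰ₁(f, g) = ℰ(f, g) + ∫ f g dμ`. -/
  closed : ∀ f : ℕ → domain,
    (∀ ε : ℝ, 0 < ε → ∃ N, ∀ m, N ≤ m → ∀ n, N ≤ n →
      form (f m - f n) (f m - f n)
        + inner ℝ (f m - f n : Lp ℝ 2 μ) (f m - f n : Lp ℝ 2 μ) < ε) →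
    ∃ g : domain, Tendsto (fun n => form (f n - g) (f n - g)
        + inner ℝ (f n - g : Lp ℝ 2 μ) (f n - g : Lp ℝ 2 μ)) atTop (𝓝 0)
  /-- Markov property: the unit contraction `(0 ∨ f) ∧ 1` operates on `𝔻` and does not
  increase the energy. -/
  markov : ∀ (f : domain) (g : Lp ℝ 2 μ),
    (∀ᵐ x ∂μ, g x = min (max ((f : Lp ℝ 2 μ) x) 0) 1) →
    ∃ hg : g ∈ domain, form ⟨g, hg⟩ ⟨g, hg⟩ ≤ form f f

namespace DirichletForm

variable {X : Type*} [MeasurableSpace X] {μ : Measure X}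

/-- The domain `𝔻`, as a type of its own: it carries the inner product
`ℰ₁(f, g) = ℰ(f, g) + ∫ f g dμ` and not the one inherited from `L²(X, μ)`. -/
def FormDomain (E : DirichletForm μ) : Type _ := E.domain

instance (E : DirichletForm μ) : AddCommGroup E.FormDomain :=
  inferInstanceAs (AddCommGroup E.domain)

instance (E : DirichletForm μ) : Module ℝ E.FormDomain :=
  inferInstanceAs (Module ℝ E.domain)

/-- The form `ℰ` on `𝔻`. -/
def energy (E : DirichletForm μ) : E.FormDomain →ₗ[ℝ] E.FormDomain →ₗ[ℝ] ℝ := E.form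

/-- The inclusion of `𝔻` into `L²(X, μ)`, as a linear map. -/
def inclₗ (E : DirichletForm μ) : E.FormDomain →ₗ[ℝ] Lp ℝ 2 μ := E.domain.subtype

/-- `ℰ₁` is an inner product on `𝔻`. -/
@[reducible] noncomputable def innerCore (E : DirichletForm μ) :
    InnerProductSpace.Core ℝ E.FormDomain where
  inner f g := E.energy f g + inner ℝ (E.inclₗ f) (E.inclₗ g)
  conj_inner_symm f g := by
    have h : E.energy g f = E.energy f g := E.symm g f
    simp [h, real_inner_comm]
  re_inner_nonneg f := by
    have h : 0 ≤ E.energy f f := E.nonneg f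
    simpa using add_nonneg h real_inner_self_nonneg
  add_left f g h := by simp [inner_add_left]; ring
  smul_left f g r := by simp [real_inner_smul_left]; ring
  definite f hf := by
    have h : 0 ≤ E.energy f f := E.nonneg f
    have h2 : 0 ≤ inner ℝ (E.inclₗ f) (E.inclₗ f) := real_inner_self_nonneg
    have h3 : inner ℝ (E.inclₗ f) (E.inclₗ f) = 0 := by linarith
    have h4 : E.inclₗ f = 0 := inner_self_eq_zero.1 h3
    exact Subtype.ext h4

noncomputable instance (E : DirichletForm μ) : NormedAddCommGroup E.FormDomain :=
  @InnerProductSpace.Core.toNormedAddCommGroup ℝ E.FormDomain _ _ _ E.innerCore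

noncomputable instance (E : DirichletForm μ) : InnerProductSpace ℝ E.FormDomain :=
  InnerProductSpace.ofCore E.innerCore.toCore

theorem inner_def (E : DirichletForm μ) (f g : E.FormDomain) :
    inner ℝ f g = E.energy f g + inner ℝ (E.inclₗ f) (E.inclₗ g) := rfl

theorem norm_inclₗ_le (E : DirichletForm μ) (f : E.FormDomain) : ‖E.inclₗ f‖ ≤ 1 * ‖f‖ := by
  have h : 0 ≤ E.energy f f := E.nonneg f
  have h1 : ‖f‖ ^ 2 = E.energy f f + ‖E.inclₗ f‖ ^ 2 := by
    rw [← real_inner_self_eq_norm_sq, ← real_inner_self_eq_norm_sq, inner_def]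
  rw [one_mul]
  exact le_of_sq_le_sq (by linarith) (norm_nonneg _)

/-- The continuous inclusion of `𝔻` (with the norm of `ℰ₁`) into `L²(X, μ)`. -/
noncomputable def incl (E : DirichletForm μ) : E.FormDomain →L[ℝ] Lp ℝ 2 μ :=
  E.inclₗ.mkContinuous 1 E.norm_inclₗ_le

/-- The embedding of `L²(X, μ)` into `𝔻*` of the Gelfand triple `𝔻 ⊂ L²(X, μ) ⊂ 𝔻*`:
`h` acts on `𝔻` by `f ↦ ∫ h f dμ`. -/
noncomputable def toDual (E : DirichletForm μ) (h : Lp ℝ 2 μ) : StrongDual ℝ E.FormDomain :=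
  (innerSL ℝ h).comp E.incl

/-- `u` belongs to `W^{1,2}([0,T]; 𝔻, 𝔻*)` and `u'` is its weak time derivative: `u` is in
`L²([0,T]; 𝔻)`, `u'` is in `L²([0,T]; 𝔻*)`, and `∫ χ u' dt = - ∫ χ' u dt` in `𝔻*` for all
smooth `χ` with compact support in `(0,T)`. -/
structure IsW12 (E : DirichletForm μ) (T : ℝ) (u : ℝ → E.FormDomain)
    (u' : ℝ → StrongDual ℝ E.FormDomain) : Prop where
  memLp : MemLp u 2 (volume.restrict (Icc 0 T))
  memLp_deriv : MemLp u' 2 (volume.restrict (Icc 0 T))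
  weak_deriv : ∀ χ : ℝ → ℝ, ContDiff ℝ ∞ χ → HasCompactSupport χ → tsupport χ ⊆ Ioo 0 T →
    ∫ t in Icc 0 T, χ t • u' t = - ∫ t in Icc 0 T, deriv χ t • E.toDual (E.incl (u t))

/-- `w` is a representative of `u` in `C([0,T]; L²(X, μ))`. -/
def IsContinuousVersion (E : DirichletForm μ) (T : ℝ) (u : ℝ → E.FormDomain)
    (w : ℝ → Lp ℝ 2 μ) : Prop :=
  ContinuousOn w (Icc 0 T) ∧ ∀ᵐ t ∂(volume.restrict (Icc 0 T)), w t = E.incl (u t)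

variable [TopologicalSpace X]

/-- `𝔻 ∩ C_c(U)`: the elements of `𝔻` that have a continuous representative with compact
support contained in `U`. -/
def contCore (E : DirichletForm μ) (U : Set X) : Set E.FormDomain :=
  {f | ∃ g : X → ℝ, Continuous g ∧ HasCompactSupport g ∧ tsupport g ⊆ U ∧ E.incl f =ᵐ[μ] g}

/-- `𝔻(U)`: the closure of `𝔻 ∩ C_c(U)` in `𝔻` for the norm of `ℰ₁`. -/
def domainOn (E : DirichletForm μ) (U : Set X) : Set E.FormDomain := closure (E.contCore U)

/-- Regularity: `𝔻 ∩ C_c(X)` is dense in `𝔻` for the norm of `ℰ₁` and dense in `C_c(X)` for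
the uniform norm. -/
def IsRegular (E : DirichletForm μ) : Prop :=
  Dense (E.contCore univ) ∧
  ∀ g : X → ℝ, Continuous g → HasCompactSupport g → ∀ ε : ℝ, 0 < ε →
    ∃ h : X → ℝ, Continuous h ∧ HasCompactSupport h ∧
      (∃ f : E.FormDomain, E.incl f =ᵐ[μ] h) ∧ ∀ x, |g x - h x| ≤ ε

/-- Strict locality (also called strong locality): `ℰ(f, g) = 0` whenever `f, g ∈ 𝔻` have compact
supports and `g` is constant on a neighbourhood of the support of `f`. -/
def IsStrictlyLocal (E : DirichletForm μ) : Prop :=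
  ∀ (f g : E.FormDomain) (K L V : Set X) (c : ℝ), IsCompact K → IsCompact L → IsOpen V → K ⊆ V →
    (∀ᵐ x ∂μ, x ∉ K → E.incl f x = 0) → (∀ᵐ x ∂μ, x ∉ L → E.incl g x = 0) →
    (∀ᵐ x ∂μ, x ∈ V → E.incl g x = c) → E.energy f g = 0

end DirichletForm

/-! The energy method: `t ↦ ‖u(t)⁺‖² / 2` does not increase in time and vanishes at time `0`.

Formally, the derivative of this function is `⟨u'(t), u(t)⁺⟩`, which by the equation equals
`-ℰ(u(t), u(t)⁺)`. The Markov property makes the latter nonpositive: normal contractions give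
`ℰ(f⁺, f⁺) ≤ ℰ(f, f)` (`DirichletForm.energy_le_of_incl_eq_posPart`), and applying this to
`f⁺ - s f⁻` with `s → 0` gives `ℰ(f⁺, f⁻) ≤ 0`, hence `ℰ(f, f⁺) ≥ 0`
(`DirichletForm.energy_posPart_nonneg`).

The chain rule is needed as an inequality only, and is obtained without regularising `u`. By
convexity of `Φ(f) = ‖f⁺‖² / 2`,
`Φ(u(t + h)) - Φ(u(t)) ≤ ⟨u(t + h) - u(t), u(t + h)⁺⟩`, and the right side is the integral of
`⟨u'(t + r), u(t + h)⁺⟩` over `r ∈ [0, h]`, because a function with a weak derivative is a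
primitive of it (`exists_sub_eq_integral_of_weakDeriv`). Integrating over `t ∈ [a, b]`, dividing by
`h` and letting `h → 0` gives the claim at Lebesgue points, by continuity of translations in `L²`
(`sub_le_integral_of_increment_le`).

The initial condition refers to the continuous representative of `u`, which has to be constructed.
The same one-sided chain rule for `± ‖f‖² / 2` yields the energy identity, and from it the bound
`‖u(t) - u(s)‖² ≤ 8 ∫ (‖u'‖² + ‖u‖²)` over `[s, t]` in `L²(X, μ)` (`norm_incl_sub_sq_le`). Hence `u`
extends continuously from a set of full measure to `[0, T]`.

The test function `1_{(a, b]} u⁺` is measurable with values in `𝔻` because the inclusion of `𝔻` into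
`L²(X, μ)` is a continuous injection between Polish spaces
(`DirichletForm.aestronglyMeasurable_of_incl`). -/

/-! ### Translations in `L²(ℝ; H)` and integrated increment inequalities -/

section Translation

variable {H : Type*} [NormedAddCommGroup H]

theorem continuous_translate_toLp {v : ℝ → H} (hv : MemLp v 2 volume) :
    Continuous fun r : ℝ =>
      Lp.compMeasurePreserving (fun t : ℝ => t + r) (measurePreserving_add_right volume r)
        (hv.toLp v) := by
  have h1 : Continuous fun r : ℝ => (⟨fun t : ℝ => t + r, by fun_prop⟩ : C(ℝ, ℝ)) :=
    (ContinuousMap.mk (fun p : ℝ × ℝ => p.2 + p.1) (by fun_prop)).curry.continuous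
  exact Continuous.compMeasurePreservingLp (continuous_const (y := hv.toLp v)) h1
    (fun r => measurePreserving_add_right volume r) (by simp)

variable [NormedSpace ℝ H]

/-- The duality pairing of `L²(ℝ; H*)` with `L²(ℝ; H)` over a set is continuous under independent
translations of its two arguments. -/
theorem tendsto_setIntegral_translate {g : ℝ → StrongDual ℝ H} {v : ℝ → H}
    (hg : MemLp g 2 volume) (hv : MemLp v 2 volume) (s : Set ℝ) :
    Tendsto (fun p : ℝ × ℝ => ∫ t in s, g (t + p.1) (v (t + p.2))) (𝓝 0)
      (𝓝 (∫ t in s, g t (v t))) := by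
  let B : StrongDual ℝ H →L[ℝ] H →L[ℝ] ℝ := ContinuousLinearMap.id ℝ _
  let RG := LpToLpRestrictCLM ℝ (StrongDual ℝ H) ℝ volume 2 s
  let RV := LpToLpRestrictCLM ℝ H ℝ volume 2 s
  have key : ∀ p : ℝ × ℝ, B.lpPairing (volume.restrict s) 2 2
      (RG (Lp.compMeasurePreserving (fun t : ℝ => t + p.1)
        (measurePreserving_add_right volume p.1) (hg.toLp g)))
      (RV (Lp.compMeasurePreserving (fun t : ℝ => t + p.2)
        (measurePreserving_add_right volume p.2) (hv.toLp v)))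
      = ∫ t in s, g (t + p.1) (v (t + p.2)) := by
    intro p
    rw [ContinuousLinearMap.lpPairing_eq_integral]
    refine integral_congr_ae ?_
    have a1 := LpToLpRestrictCLM_coeFn ℝ s (Lp.compMeasurePreserving (fun t : ℝ => t + p.1)
        (measurePreserving_add_right volume p.1) (hg.toLp g))
    have a2 := LpToLpRestrictCLM_coeFn ℝ s (Lp.compMeasurePreserving (fun t : ℝ => t + p.2)
        (measurePreserving_add_right volume p.2) (hv.toLp v))
    have b1 := ae_restrict_of_ae (s := s) (Lp.coeFn_compMeasurePreserving (hg.toLp g)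
      (measurePreserving_add_right volume p.1))
    have b2 := ae_restrict_of_ae (s := s) (Lp.coeFn_compMeasurePreserving (hv.toLp v)
      (measurePreserving_add_right volume p.2))
    have c1 := ae_restrict_of_ae (s := s)
      ((measurePreserving_add_right volume p.1).quasiMeasurePreserving.ae hg.coeFn_toLp)
    have c2 := ae_restrict_of_ae (s := s)
      ((measurePreserving_add_right volume p.2).quasiMeasurePreserving.ae hv.coeFn_toLp)
    filter_upwards [a1, a2, b1, b2, c1, c2] with t h1 h2 h3 h4 h5 h6
    simp only [RG, RV, h1, h2, h3, h4, Function.comp, h5, h6]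
    rfl
  have hc : Continuous fun p : ℝ × ℝ => ∫ t in s, g (t + p.1) (v (t + p.2)) := by
    simp_rw [← key]
    have c1 := RG.continuous.comp ((continuous_translate_toLp hg).comp
      (continuous_fst (X := ℝ) (Y := ℝ)))
    have c2 := RV.continuous.comp ((continuous_translate_toLp hv).comp
      (continuous_snd (X := ℝ) (Y := ℝ)))
    exact (((B.lpPairing (volume.restrict s) 2 2).continuous.comp c1).clm_apply c2)
  simpa using hc.tendsto 0

theorem integrable_translate_pairing {g : ℝ → StrongDual ℝ H} {v : ℝ → H}
    (hg : Integrable g) (hv : Integrable v) (c : ℝ) :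
    Integrable (fun p : ℝ × ℝ => g (p.1 + p.2) (v (p.1 + c))) (volume.prod volume) := by
  have hv' : Integrable fun t => v (t + c) := hv.comp_add_right c
  have h1 : Integrable (fun p : ℝ × ℝ => g p.2 (v (p.1 + c))) (volume.prod volume) := by
    have h0 : Integrable (fun p : ℝ × ℝ => ‖v (p.1 + c)‖ * ‖g p.2‖) (volume.prod volume) :=
      hv'.norm.mul_prod hg.norm
    refine h0.mono' ?_ (ae_of_all _ fun p => ?_)
    · have m1 : AEStronglyMeasurable (fun p : ℝ × ℝ => g p.2) (volume.prod volume) :=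
        hg.aestronglyMeasurable.comp_snd
      have m2 : AEStronglyMeasurable (fun p : ℝ × ℝ => v (p.1 + c)) (volume.prod volume) :=
        hv'.aestronglyMeasurable.comp_fst
      exact (ContinuousLinearMap.id ℝ (StrongDual ℝ H)).aestronglyMeasurable_comp₂ m1 m2
    · rw [mul_comm]; exact (g p.2).le_opNorm _
  -- the shear `(t, r) ↦ (t, t + r)` preserves the product measure
  have hmp : MeasurePreserving (fun p : ℝ × ℝ => (p.1, p.1 + p.2)) (volume.prod volume)
      (volume.prod volume) := measurePreserving_prod_add volume volume
  exact hmp.integrable_comp_of_integrable h1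

/-- A one-sided fundamental theorem of calculus. If the increments of `N` over `[t, t + h]` are at
most `∫ r in t..t + h, g r (v (t + σ h))`, then those over `[a, b]` are at most
`∫ t in a..b, g t (v t)`, for all Lebesgue points `a ≤ b` of `N`. The hypothesis is averaged over
`t ∈ [a, b]` and divided by `h`; the left side telescopes to difference quotients of the primitive
of `N`, and the right side converges by continuity of translations in `L²`, so that no
differentiability of `v` is needed. The parameter `σ` is `1` or `0` in applications: it selects the
endpoint of the short interval at which `v` is evaluated. -/
theorem sub_le_integral_of_increment_le {g : ℝ → StrongDual ℝ H} {v : ℝ → H} {N : ℝ → ℝ} {T σ : ℝ}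
    (hg1 : Integrable g) (hv1 : Integrable v)
    (hg : MemLp g 2 volume) (hv : MemLp v 2 volume) (hN : Integrable N)
    (hinc : ∀ h, 0 < h → ∀ᵐ t, 0 < t → t + h < T →
      N (t + h) - N t ≤ ∫ r in 0..h, g (t + r) (v (t + σ * h)))
    {a b : ℝ} (ha : 0 < a) (hab : a ≤ b) (hb : b < T)
    (hNa : HasDerivAt (fun x => ∫ t in 0..x, N t) (N a) a)
    (hNb : HasDerivAt (fun x => ∫ t in 0..x, N t) (N b) b) :
    N b - N a ≤ ∫ t in a..b, g t (v t) := by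
  set F : ℝ → ℝ := fun x => ∫ t in 0..x, N t with hF
  set G : ℝ × ℝ → ℝ := fun p => ∫ t in Ioc a b, g (t + p.1) (v (t + p.2)) with hG
  have hNi : ∀ x y, IntervalIntegrable N volume x y := fun x y => hN.intervalIntegrable
  have hGlim : Tendsto G (𝓝 0) (𝓝 (∫ t in Ioc a b, g t (v t))) :=
    tendsto_setIntegral_translate hg hv _
  -- the averaged inequality
  have hstep : ∀ h, 0 < h → b + h < T →
      (F (b + h) - F b) - (F (a + h) - F a) ≤ ∫ r in 0..h, G (r, σ * h) := by
    intro h hh hbh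
    have e1 : (F (b + h) - F b) - (F (a + h) - F a) = ∫ t in a..b, (N (t + h) - N t) := by
      rw [intervalIntegral.integral_sub (hN.comp_add_right h).intervalIntegrable (hNi _ _),
        intervalIntegral.integral_comp_add_right N h]
      have h1 := intervalIntegral.integral_interval_sub_left (hNi 0 (b + h)) (hNi 0 (a + h))
      have h2 := intervalIntegral.integral_interval_sub_left (hNi 0 b) (hNi 0 a)
      simp only [hF]; linarith
    have hint : Integrable (fun p : ℝ × ℝ => g (p.1 + p.2) (v (p.1 + σ * h)))
        ((volume.restrict (Ioc a b)).prod (volume.restrict (Ioc 0 h))) := by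
      rw [Measure.prod_restrict]
      exact (integrable_translate_pairing hg1 hv1 (σ * h)).restrict
    have e2 : ∫ r in 0..h, G (r, σ * h)
        = ∫ t in a..b, ∫ r in 0..h, g (t + r) (v (t + σ * h)) := by
      rw [intervalIntegral.integral_of_le hh.le, intervalIntegral.integral_of_le hab]
      simp_rw [intervalIntegral.integral_of_le hh.le]
      exact (integral_integral_swap hint).symm
    rw [e1, e2, intervalIntegral.integral_of_le hab, intervalIntegral.integral_of_le hab]
    refine integral_mono_ae ((hN.comp_add_right h).sub hN).restrict ?_ ?_
    · simp_rw [intervalIntegral.integral_of_le hh.le]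
      exact hint.integral_prod_left
    · filter_upwards [ae_restrict_of_ae (hinc h hh), ae_restrict_mem measurableSet_Ioc] with t h1 h2
      exact h1 (ha.trans h2.1) (by linarith [h2.2])
  rw [intervalIntegral.integral_of_le hab]
  refine le_of_forall_pos_le_add fun ε hε => ?_
  obtain ⟨δ, hδ, hGδ⟩ := Metric.eventually_nhds_iff.1
    (hGlim.eventually (eventually_le_nhds (lt_add_of_pos_right _ hε)))
  have hD : Tendsto (fun h => h⁻¹ * ((F (b + h) - F b) - (F (a + h) - F a))) (𝓝[>] 0)
      (𝓝 (N b - N a)) := by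
    have h1 := hNb.tendsto_slope_zero_right
    have h2 := hNa.tendsto_slope_zero_right
    refine (h1.sub h2).congr fun h => ?_
    simp only [smul_eq_mul]; ring
  have hlt : ∀ᶠ h : ℝ in 𝓝[>] 0, |σ * h| < δ := by
    have : Tendsto (fun h : ℝ => |σ * h|) (𝓝[>] 0) (𝓝 0) := by
      have : Continuous fun h : ℝ => |σ * h| := by fun_prop
      simpa using (this.tendsto 0).mono_left nhdsWithin_le_nhds
    exact this.eventually (gt_mem_nhds hδ)
  refine le_of_tendsto hD ?_
  filter_upwards [hlt, Ioo_mem_nhdsGT (lt_min hδ (sub_pos.2 hb))] with h h1 h2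
  have hh : 0 < h := h2.1
  have hhδ : h < δ := h2.2.trans_le (min_le_left _ _)
  have hhT : b + h < T := by linarith [h2.2.trans_le (min_le_right δ (T - b))]
  refine (mul_le_mul_of_nonneg_left (hstep h hh hhT) (inv_nonneg.2 hh.le)).trans ?_
  have hnorm := intervalIntegral.integral_mono_on_of_le_Ioo (μ := volume) hh.le (f := fun r => G (r, σ * h))
    (g := fun _ => (∫ t in Ioc a b, g t (v t)) + ε) ?_ (by simp) ?_
  · rw [intervalIntegral.integral_const, smul_eq_mul, sub_zero] at hnorm
    calc _ ≤ h⁻¹ * (h * ((∫ t in Ioc a b, g t (v t)) + ε)) :=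
          mul_le_mul_of_nonneg_left hnorm (inv_nonneg.2 hh.le)
      _ = _ := by field_simp
  · rw [intervalIntegrable_iff_integrableOn_Ioc_of_le hh.le]
    have := (integrable_translate_pairing hg1 hv1 (σ * h)).restrict (s := Ioc a b ×ˢ Ioc 0 h)
    rw [← Measure.prod_restrict] at this
    exact this.integral_prod_right
  · intro r hr
    refine hGδ ?_
    rw [dist_zero_right, Prod.norm_def, max_lt_iff]
    refine ⟨?_, h1⟩
    rw [Real.norm_eq_abs, abs_of_pos hr.1]
    exact hr.2.trans hhδ

end Translation

/-! ### Weak derivatives with values in a Banach space -/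

section WeakDerivative

open scoped Convolution

/-- The smooth step `x ↦ ∫ y ≤ x, ρ y` from `0` to `1`, where `ρ` is a normalised bump at `0`. -/
noncomputable def bumpStep (φ : ContDiffBump (0 : ℝ)) (x : ℝ) : ℝ :=
  ∫ y in Iic x, φ.normed volume y

theorem bumpStep_nonneg (φ : ContDiffBump (0 : ℝ)) (x : ℝ) : 0 ≤ bumpStep φ x :=
  setIntegral_nonneg measurableSet_Iic fun y _ => φ.nonneg_normed y

theorem bumpStep_le_one (φ : ContDiffBump (0 : ℝ)) (x : ℝ) : bumpStep φ x ≤ 1 := by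
  rw [← φ.integral_normed (μ := volume)]
  exact setIntegral_le_integral φ.integrable_normed (ae_of_all _ φ.nonneg_normed)

theorem bumpStep_of_le (φ : ContDiffBump (0 : ℝ)) {x : ℝ} (hx : x ≤ -φ.rOut) :
    bumpStep φ x = 0 := by
  refine setIntegral_eq_zero_of_forall_eq_zero fun y hy => ?_
  rw [← Function.notMem_support, φ.support_normed_eq, Metric.mem_ball, dist_zero_right,
    Real.norm_eq_abs, not_lt]
  exact le_abs.2 (Or.inr (by linarith [mem_Iic.1 hy]))

theorem bumpStep_of_ge (φ : ContDiffBump (0 : ℝ)) {x : ℝ} (hx : φ.rOut ≤ x) :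
    bumpStep φ x = 1 := by
  rw [← φ.integral_normed (μ := volume)]
  refine setIntegral_eq_integral_of_forall_compl_eq_zero fun y hy => ?_
  rw [← Function.notMem_support, φ.support_normed_eq, Metric.mem_ball, dist_zero_right,
    Real.norm_eq_abs, not_lt]
  exact le_abs.2 (Or.inl (by linarith [not_le.1 (fun h => hy (mem_Iic.2 h))]))

theorem hasDerivAt_bumpStep (φ : ContDiffBump (0 : ℝ)) (x : ℝ) :
    HasDerivAt (bumpStep φ) (φ.normed volume x) x := by
  have h : bumpStep φ = fun x => bumpStep φ 0 + ∫ y in 0..x, φ.normed volume y := by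
    ext x
    rw [bumpStep, bumpStep, ← intervalIntegral.integral_Iic_sub_Iic
      φ.integrable_normed.integrableOn φ.integrable_normed.integrableOn]
    ring
  rw [h]
  exact (φ.continuous_normed.integral_hasStrictDerivAt 0 x).hasDerivAt.const_add _

theorem contDiff_bumpStep (φ : ContDiffBump (0 : ℝ)) : ContDiff ℝ ∞ (bumpStep φ) := by
  have hd : deriv (bumpStep φ) = φ.normed volume := funext fun x => (hasDerivAt_bumpStep φ x).deriv
  refine contDiff_infty_iff_deriv.2 ⟨fun x => (hasDerivAt_bumpStep φ x).differentiableAt, ?_⟩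
  rw [hd]
  exact φ.contDiff_normed

variable {F : Type*} [NormedAddCommGroup F] [NormedSpace ℝ F] [CompleteSpace F]

/-- A function with an integrable weak derivative on `(0, T)` is a.e. equal to a primitive of it.
The weak formulation is tested with mollified indicators of `(s, t)`, and the exceptional set
consists of the points where the mollifications of `f` do not converge to `f`. -/
theorem exists_sub_eq_integral_of_weakDeriv {T : ℝ} {f f' : ℝ → F}
    (hf : Integrable f) (hf' : Integrable f')
    (hweak : ∀ χ : ℝ → ℝ, ContDiff ℝ ∞ χ → HasCompactSupport χ → tsupport χ ⊆ Ioo 0 T →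
      ∫ t, χ t • f' t = - ∫ t, deriv χ t • f t) :
    ∃ S : Set ℝ, (∀ᵐ t, t ∈ S) ∧ ∀ s ∈ S, ∀ t ∈ S, 0 < s → s < t → t < T →
      f t - f s = ∫ r in s..t, f' r := by
  let φ : ℕ → ContDiffBump (0 : ℝ) := fun n =>
    { rIn := 1 / ((n : ℝ) + 1)
      rOut := 2 * (1 / ((n : ℝ) + 1))
      rIn_pos := by positivity
      rIn_lt_rOut := by
        have : 0 < 1 / ((n : ℝ) + 1) := by positivity
        linarith }
  have hφ : Tendsto (fun n => (φ n).rOut) atTop (𝓝 0) := by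
    have h := (tendsto_one_div_add_atTop_nhds_zero_nat (𝕜 := ℝ)).const_mul (2 : ℝ)
    rwa [mul_zero] at h
  have hconv := ContDiffBump.ae_convolution_tendsto_right_of_locallyIntegrable (μ := volume)
    (K := 2) hφ (Eventually.of_forall fun n => le_rfl) hf.locallyIntegrable
  refine ⟨{x | Tendsto (fun n => ((φ n).normed volume
    ⋆[ContinuousLinearMap.lsmul ℝ ℝ, volume] f) x) atTop (𝓝 (f x))}, hconv,
    fun s hs t ht h0 hst htT => ?_⟩
  rw [mem_ofPred_eq] at hs ht
  let χ : ℕ → ℝ → ℝ := fun n x => bumpStep (φ n) (x - s) - bumpStep (φ n) (x - t)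
  have hχd : ∀ n x, deriv (χ n) x = (φ n).normed volume (s - x) - (φ n).normed volume (t - x) := by
    intro n x
    rw [← neg_sub x s, ← neg_sub x t, ContDiffBump.normed_neg, ContDiffBump.normed_neg]
    exact (((hasDerivAt_bumpStep (φ n) (x - s)).comp_sub_const x s).sub
      ((hasDerivAt_bumpStep (φ n) (x - t)).comp_sub_const x t)).deriv
  have hχs : ∀ n x, x ∉ Icc (s - (φ n).rOut) (t + (φ n).rOut) → χ n x = 0 := by
    intro n x hx
    simp only [χ]
    rcases lt_or_ge x (s - (φ n).rOut) with h | h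
    · rw [bumpStep_of_le _ (by linarith), bumpStep_of_le _ (by linarith), sub_zero]
    · have h2 : t + (φ n).rOut < x := not_le.1 fun h3 => hx ⟨h, h3⟩
      rw [bumpStep_of_ge _ (by linarith), bumpStep_of_ge _ (by linarith), sub_self]
  have hint : ∀ n x, Integrable fun y => (φ n).normed volume (x - y) • f y := by
    intro n x
    obtain ⟨C, hC⟩ := ((φ n).hasCompactSupport_normed (μ := volume)).exists_bound_of_continuous
      (φ n).continuous_normed
    refine hf.bdd_smul C ?_ (ae_of_all _ fun y => hC _)
    exact ((φ n).continuous_normed.comp (continuous_const.sub continuous_id)).aestronglyMeasurable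
  -- the weak formulation with the smooth approximations of the indicator of `(s, t)`
  have hev : ∀ᶠ n in atTop, ∫ r, χ n r • f' r
      = ((φ n).normed volume ⋆[ContinuousLinearMap.lsmul ℝ ℝ, volume] f) t
        - ((φ n).normed volume ⋆[ContinuousLinearMap.lsmul ℝ ℝ, volume] f) s := by
    filter_upwards [hφ.eventually (gt_mem_nhds h0), hφ.eventually (gt_mem_nhds (sub_pos.2 htT))]
      with n h1 h2
    have hsub : tsupport (χ n) ⊆ Icc (s - (φ n).rOut) (t + (φ n).rOut) :=
      closure_minimal (fun x hx => by_contra fun h => hx (hχs n x h)) isClosed_Icc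
    rw [hweak (χ n) ?_ ?_ ?_]
    · rw [convolution_eq_swap, convolution_eq_swap]
      simp only [ContinuousLinearMap.lsmul_apply]
      rw [← integral_sub (hint n t) (hint n s), ← integral_neg]
      refine integral_congr_ae (ae_of_all _ fun y => ?_)
      simp only [hχd, sub_smul]
      abel
    · exact ((contDiff_bumpStep _).comp (contDiff_id.sub contDiff_const)).sub
        ((contDiff_bumpStep _).comp (contDiff_id.sub contDiff_const))
    · exact HasCompactSupport.of_support_subset_isCompact isCompact_Icc
        ((subset_tsupport _).trans hsub)
    · exact hsub.trans (Icc_subset_Ioo (by linarith) (by linarith))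
  have hlim1 : Tendsto (fun n => ∫ r, χ n r • f' r) atTop (𝓝 (f t - f s)) :=
    (ht.sub hs).congr' (hev.mono fun n h => h.symm)
  have hlim2 : Tendsto (fun n => ∫ r, χ n r • f' r) atTop
      (𝓝 (∫ r, (Ioc s t).indicator f' r)) := by
    refine tendsto_integral_of_dominated_convergence (fun r => ‖f' r‖) (fun n => ?_) hf'.norm
      (fun n => ae_of_all _ fun r => ?_) ?_
    · refine AEStronglyMeasurable.smul ?_ hf'.aestronglyMeasurable
      exact (((contDiff_bumpStep (φ n)).continuous.comp (continuous_id.sub continuous_const)).sub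
        ((contDiff_bumpStep (φ n)).continuous.comp
          (continuous_id.sub continuous_const))).aestronglyMeasurable
    · rw [norm_smul]
      refine mul_le_of_le_one_left (norm_nonneg _) ?_
      rw [Real.norm_eq_abs, abs_le]
      constructor <;> simp only [χ] <;>
        linarith [bumpStep_nonneg (φ n) (r - s), bumpStep_nonneg (φ n) (r - t),
          bumpStep_le_one (φ n) (r - s), bumpStep_le_one (φ n) (r - t)]
    · have hne : ∀ c : ℝ, ∀ᵐ r : ℝ, r ≠ c := fun c => by simp [ae_iff, measure_singleton]
      filter_upwards [hne s, hne t] with r hrs hrt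
      refine tendsto_const_nhds.congr' ?_
      have p1 : 0 < |r - s| := abs_pos.2 (sub_ne_zero.2 hrs)
      have p2 : 0 < |r - t| := abs_pos.2 (sub_ne_zero.2 hrt)
      have step : ∀ c n, (φ n).rOut < |r - c| →
          bumpStep (φ n) (r - c) = if c < r then 1 else 0 := by
        intro c n hn
        split_ifs with h
        · rw [abs_of_pos (sub_pos.2 h)] at hn
          exact bumpStep_of_ge _ hn.le
        · rw [abs_of_nonpos (by linarith)] at hn
          exact bumpStep_of_le _ (by linarith)
      filter_upwards [hφ.eventually (gt_mem_nhds p1), hφ.eventually (gt_mem_nhds p2)] with n h1 h2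
      simp only [χ, step s n h1, step t n h2, indicator, mem_Ioc]
      rcases lt_or_gt_of_ne hrs with h3 | h3
      · have : ¬ t < r := by linarith
        simp [not_lt.2 h3.le, this]
      · rcases lt_or_gt_of_ne hrt with h4 | h4
        · simp [h3, h4.le, not_lt.2 h4.le]
        · simp [h3, h4, not_le.2 h4]
  rw [tendsto_nhds_unique hlim1 hlim2, integral_indicator measurableSet_Ioc,
    intervalIntegral.integral_of_le hst.le]

end WeakDerivative

/-! ### The positive part in `L²(X, μ)` -/

section PosPart

variable {X : Type*} [MeasurableSpace X] {μ : Measure X}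

theorem Lp_coeFn_posPart (f : Lp ℝ 2 μ) : (f⁺ : Lp ℝ 2 μ) =ᵐ[μ] fun x => max (f x) 0 := by
  rw [posPart_def]
  filter_upwards [Lp.coeFn_sup f 0, Lp.coeFn_zero ℝ 2 μ] with x h1 h2
  rw [h1, Pi.sup_apply, h2]
  rfl

/-- The subgradient inequality for the convex function `f ↦ ‖f⁺‖² / 2` on `L²(X, μ)`, whose
gradient at `y` is `y⁺`. -/
theorem Lp_norm_posPart_sq_sub_le (x y : Lp ℝ 2 μ) :
    ‖y⁺‖ ^ 2 / 2 - ‖x⁺‖ ^ 2 / 2 ≤ inner ℝ (y⁺) (y - x) := by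
  have h : 0 ≤ inner ℝ (y⁺) (y - x) + inner ℝ (x⁺) (x⁺) / 2 - inner ℝ (y⁺) (y⁺) / 2 := by
    have i := fun a b : Lp ℝ 2 μ => L2.integrable_inner (𝕜 := ℝ) a b
    have e : inner ℝ (y⁺) (y - x) + inner ℝ (x⁺) (x⁺) / 2 - inner ℝ (y⁺) (y⁺) / 2
        = ∫ p, (inner ℝ ((y⁺ : Lp ℝ 2 μ) p) ((y - x : Lp ℝ 2 μ) p)
          + inner ℝ ((x⁺ : Lp ℝ 2 μ) p) ((x⁺ : Lp ℝ 2 μ) p) / 2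
          - inner ℝ ((y⁺ : Lp ℝ 2 μ) p) ((y⁺ : Lp ℝ 2 μ) p) / 2) ∂μ := by
      have i2 : Integrable (fun p => inner ℝ ((y⁺ : Lp ℝ 2 μ) p) ((y - x : Lp ℝ 2 μ) p)
          + inner ℝ ((x⁺ : Lp ℝ 2 μ) p) ((x⁺ : Lp ℝ 2 μ) p) / 2) μ :=
        (i _ _).add ((i _ _).div_const 2)
      rw [integral_sub i2 ((i _ _).div_const 2),
        integral_add (i _ _) ((i _ _).div_const 2), integral_div, integral_div]
      rfl
    rw [e]
    refine integral_nonneg_of_ae ?_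
    filter_upwards [Lp_coeFn_posPart x, Lp_coeFn_posPart y, Lp.coeFn_sub y x] with p h1 h2 h3
    simp only [Pi.zero_apply, h1, h2, h3, Pi.sub_apply, RCLike.inner_apply, conj_trivial]
    rcases le_total (y p) 0 with hy | hy <;> rcases le_total (x p) 0 with hx | hx <;>
      simp only [max_eq_left, max_eq_right, hx, hy] <;> nlinarith [sq_nonneg (x p - y p), mul_self_nonneg (x p)]
  rw [real_inner_self_eq_norm_sq, real_inner_self_eq_norm_sq] at h
  linarith

end PosPart

/-! ### Completeness of the form domain and the energy of the positive part -/

namespace DirichletForm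

variable {X : Type*} [MeasurableSpace X] {μ : Measure X}

theorem incl_apply (E : DirichletForm μ) (f : E.FormDomain) : E.incl f = E.inclₗ f := rfl

theorem incl_injective (E : DirichletForm μ) : Function.Injective E.incl :=
  fun _ _ h => Subtype.ext h

theorem norm_sq_eq (E : DirichletForm μ) (f : E.FormDomain) :
    ‖f‖ ^ 2 = E.energy f f + ‖E.incl f‖ ^ 2 := by
  rw [← real_inner_self_eq_norm_sq, ← real_inner_self_eq_norm_sq, inner_def]
  rfl

theorem energy_comm (E : DirichletForm μ) (f g : E.FormDomain) : E.energy f g = E.energy g f :=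
  E.symm f g

theorem energy_self_nonneg (E : DirichletForm μ) (f : E.FormDomain) : 0 ≤ E.energy f f :=
  E.nonneg f

instance completeSpace_formDomain (E : DirichletForm μ) : CompleteSpace E.FormDomain := by
  refine Metric.complete_of_cauchySeq_tendsto fun f hf => ?_
  obtain ⟨g, hg⟩ := E.closed f fun ε hε => by
    obtain ⟨N, hN⟩ := Metric.cauchySeq_iff.1 hf (√ε) (Real.sqrt_pos.2 hε)
    refine ⟨N, fun m hm n hn => ?_⟩
    have h := hN m hm n hn
    rw [dist_eq_norm, Real.lt_sqrt (norm_nonneg _), ← real_inner_self_eq_norm_sq] at h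
    exact h
  let g' : E.FormDomain := g
  refine ⟨g', tendsto_iff_norm_sub_tendsto_zero.2 ?_⟩
  have h2 : Tendsto (fun n => ‖f n - g'‖ ^ 2) atTop (𝓝 0) := by
    simp_rw [← real_inner_self_eq_norm_sq]
    exact hg
  have h3 := (Real.continuous_sqrt.tendsto 0).comp h2
  rw [Real.sqrt_zero] at h3
  exact h3.congr fun n => Real.sqrt_sq (norm_nonneg _)

theorem denseRange_adjoint_incl (E : DirichletForm μ) :
    DenseRange (ContinuousLinearMap.adjoint E.incl) := by
  have h : (ContinuousLinearMap.adjoint E.incl).rangeᗮ = ⊥ := by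
    rw [ContinuousLinearMap.orthogonal_range, ContinuousLinearMap.adjoint_adjoint]
    exact LinearMap.ker_eq_bot.2 E.incl_injective
  have h2 := Submodule.topologicalClosure_eq_top_iff.2 h
  exact Submodule.dense_iff_topologicalClosure_eq_top.2 h2

/-- Lower semicontinuity of the norm of `𝔻` under weak convergence in `L²(X, μ)`: it suffices to
test against the dense range of the adjoint of the inclusion. -/
theorem norm_le_of_tendsto_inner (E : DirichletForm μ) {f : ℕ → E.FormDomain} {g : E.FormDomain}
    {C : ℝ} (hC : ∀ n, ‖f n‖ ≤ C)
    (h : ∀ y, Tendsto (fun n => inner ℝ (E.incl (f n)) y) atTop (𝓝 (inner ℝ (E.incl g) y))) :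
    ‖g‖ ≤ C := by
  have key : ∀ z : E.FormDomain, inner ℝ g z ≤ C * ‖z‖ := by
    intro z
    refine E.denseRange_adjoint_incl.induction_on z
      (isClosed_le (by fun_prop) (by fun_prop)) fun y => ?_
    rw [ContinuousLinearMap.adjoint_inner_right]
    refine le_of_tendsto (h y) (Eventually.of_forall fun n => ?_)
    rw [← ContinuousLinearMap.adjoint_inner_right]
    exact (real_inner_le_norm _ _).trans (mul_le_mul_of_nonneg_right (hC n) (norm_nonneg _))
  have h1 := key g
  rw [real_inner_self_eq_norm_sq, sq] at h1
  rcases (norm_nonneg g).eq_or_lt with h0 | h0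
  · rw [← h0]; exact (norm_nonneg _).trans (hC 0)
  · exact le_of_mul_le_mul_right h1 h0

/-- Passing to the positive part does not increase the energy. The truncations `f⁺ ∧ (n + 1)` have
energy at most `ℰ(f, f)` by the Markov property, and they converge to `f⁺` in `L²(X, μ)`. -/
theorem energy_le_of_incl_eq_posPart (E : DirichletForm μ) {f g : E.FormDomain}
    (h : E.incl g = (E.incl f)⁺) : E.energy g g ≤ E.energy f f := by
  have hg : ∀ᵐ x ∂μ, E.incl g x = max (E.incl f x) 0 := h ▸ Lp_coeFn_posPart (E.incl f)
  -- the truncations `f⁺ ∧ (n + 1)` are rescaled unit contractions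
  have htr : ∀ n : ℕ, ∃ k : E.FormDomain, E.energy k k ≤ E.energy f f ∧
      ∀ᵐ x ∂μ, E.incl k x = min (E.incl g x) (n + 1) := by
    intro n
    have hn : (0 : ℝ) < n + 1 := by positivity
    set c : ℝ := n + 1
    let f' : E.FormDomain := c⁻¹ • f
    have hm : MemLp (fun x => min (max (E.incl f' x) 0) 1) 2 μ := by
      refine (Lp.memLp (E.incl f')).of_le ?_ (ae_of_all _ fun x => ?_)
      · exact ((Lp.aestronglyMeasurable _).aemeasurable.max aemeasurable_const |>.min
          aemeasurable_const).aestronglyMeasurable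
      · rw [Real.norm_eq_abs, Real.norm_eq_abs, abs_of_nonneg (le_min (le_max_right _ _) zero_le_one)]
        exact (min_le_left _ _).trans (max_le (le_abs_self _) (abs_nonneg _))
    obtain ⟨hk, hk2⟩ := E.markov f' (hm.toLp _) hm.coeFn_toLp
    let k : E.FormDomain := ⟨hm.toLp _, hk⟩
    have hk3 : E.energy k k ≤ E.energy f' f' := hk2
    refine ⟨c • k, ?_, ?_⟩
    · have e1 : E.energy (c • k) (c • k) = c * (c * E.energy k k) := by simp
      have e2 : E.energy f' f' = c⁻¹ * (c⁻¹ * E.energy f f) := by simp [f']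
      rw [e2] at hk3
      calc _ ≤ c * (c * (c⁻¹ * (c⁻¹ * E.energy f f))) := by rw [e1]; gcongr
        _ = _ := by field_simp
    · have e1 : E.incl (c • k) =ᵐ[μ] fun x => c * (hm.toLp _) x := by
        rw [map_smul]; exact Lp.coeFn_smul c (hm.toLp _)
      have e2 : E.incl f' =ᵐ[μ] fun x => c⁻¹ * E.incl f x := by
        rw [map_smul]; exact Lp.coeFn_smul c⁻¹ (E.incl f)
      filter_upwards [e1, e2, hm.coeFn_toLp, hg] with x h1 h2 h3 h4
      rw [h1, h3, h2, h4, mul_min_of_nonneg _ _ hn.le, mul_max_of_nonneg _ _ hn.le,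
        mul_inv_cancel_left₀ hn.ne', mul_zero, mul_one]
  choose k hk1 hk2 using htr
  have hnorm : ∀ n, ‖E.incl (k n)‖ ≤ ‖E.incl g‖ := by
    intro n
    refine Lp.norm_le_norm_of_ae_le ?_
    filter_upwards [hk2 n, hg] with x h1 h2
    have h3 : 0 ≤ E.incl g x := h2 ▸ le_max_right _ _
    have : (0 : ℝ) < n + 1 := by positivity
    rw [h1, Real.norm_eq_abs, Real.norm_eq_abs, abs_of_nonneg (le_min h3 this.le), abs_of_nonneg h3]
    exact min_le_left _ _
  have hle : ‖g‖ ≤ √(E.energy f f + ‖E.incl g‖ ^ 2) := by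
    refine E.norm_le_of_tendsto_inner (f := k) (fun n => ?_) fun y => ?_
    · refine Real.le_sqrt_of_sq_le ?_
      rw [norm_sq_eq]
      have := pow_le_pow_left₀ (norm_nonneg _) (hnorm n) 2
      linarith [hk1 n]
    · simp_rw [L2.inner_def]
      refine tendsto_integral_of_dominated_convergence (fun x => ‖E.incl g x‖ * ‖y x‖)
        (fun n => ?_) ?_ (fun n => ?_) ?_
      · exact (Lp.aestronglyMeasurable _).inner (Lp.aestronglyMeasurable _)
      · exact (Lp.memLp (E.incl g)).norm.integrable_mul (Lp.memLp y).norm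
      · filter_upwards [hk2 n, hg] with x h1 h2
        refine (norm_inner_le_norm _ _).trans (mul_le_mul_of_nonneg_right ?_ (norm_nonneg _))
        have h3 : 0 ≤ E.incl g x := h2 ▸ le_max_right _ _
        have : (0 : ℝ) < n + 1 := by positivity
        rw [h1, Real.norm_eq_abs, Real.norm_eq_abs, abs_of_nonneg (le_min h3 this.le),
          abs_of_nonneg h3]
        exact min_le_left _ _
      · filter_upwards [ae_all_iff.2 hk2] with x h1
        refine tendsto_const_nhds.congr' ?_
        filter_upwards [eventually_ge_atTop ⌈E.incl g x⌉₊] with n hn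
        have : E.incl g x ≤ n + 1 := (Nat.le_ceil _).trans (by
          have : ((⌈E.incl g x⌉₊ : ℕ) : ℝ) ≤ n := by exact_mod_cast hn
          linarith)
        rw [h1 n, min_eq_left this]
  have h0 : 0 ≤ E.energy f f + ‖E.incl g‖ ^ 2 :=
    add_nonneg (E.energy_self_nonneg f) (sq_nonneg _)
  have h1 := (Real.le_sqrt (norm_nonneg _) h0).1 hle
  rw [norm_sq_eq] at h1
  linarith

/-- `ℰ(f, f⁺) ≥ 0`, because `ℰ(f⁺, f⁻) ≤ 0`. -/
theorem energy_posPart_nonneg (E : DirichletForm μ) {f g : E.FormDomain}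
    (h : E.incl g = (E.incl f)⁺) : 0 ≤ E.energy f g := by
  -- comparing `f⁺` with `f⁺ - s f⁻`, whose positive part is `f⁺`
  have hs : ∀ s : ℝ, 0 < s → 2 * E.energy g (g - f) ≤ s * E.energy (g - f) (g - f) := by
    intro s hs
    have h1 : E.incl g = (E.incl (g - s • (g - f)))⁺ := by
      refine Lp.ext ?_
      have e0 : E.incl g =ᵐ[μ] fun x => max (E.incl f x) 0 := h ▸ Lp_coeFn_posPart (E.incl f)
      have e1 : E.incl (g - s • (g - f)) =ᵐ[μ]
          fun x => E.incl g x - s * (E.incl g x - E.incl f x) := by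
        rw [map_sub, map_smul, map_sub]
        filter_upwards [Lp.coeFn_sub (E.incl g) (s • (E.incl g - E.incl f)),
          Lp.coeFn_smul s (E.incl g - E.incl f), Lp.coeFn_sub (E.incl g) (E.incl f)] with x a b c
        rw [a, Pi.sub_apply, b, Pi.smul_apply, c, Pi.sub_apply, smul_eq_mul]
      filter_upwards [e0, e1, Lp_coeFn_posPart (E.incl (g - s • (g - f)))] with x a b c
      rw [c, b, a]
      rcases le_total (E.incl f x) 0 with h0 | h0
      · rw [max_eq_right h0, max_eq_right]
        nlinarith
      · rw [max_eq_left h0, sub_self, mul_zero, sub_zero, max_eq_left h0]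
    have h2 := E.energy_le_of_incl_eq_posPart h1
    have h3 : E.energy (g - s • (g - f)) (g - s • (g - f))
        = E.energy g g - 2 * s * E.energy g (g - f) + s * s * E.energy (g - f) (g - f) := by
      rw [map_sub (E.energy), LinearMap.sub_apply, map_sub (E.energy g), map_smul (E.energy),
        LinearMap.smul_apply, map_sub (E.energy (g - f)), map_smul, map_smul,
        E.energy_comm (g - f) g]
      simp only [smul_eq_mul]
      ring
    rw [h3] at h2
    refine le_of_mul_le_mul_left ?_ hs
    linarith
  have h1 : 2 * E.energy g (g - f) ≤ 0 := by
    have hl : Tendsto (fun s : ℝ => s * E.energy (g - f) (g - f)) (𝓝[>] 0) (𝓝 0) := by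
      have : Continuous fun s : ℝ => s * E.energy (g - f) (g - f) := by fun_prop
      simpa using (this.tendsto 0).mono_left nhdsWithin_le_nhds
    refine ge_of_tendsto hl ?_
    filter_upwards [self_mem_nhdsWithin] with s h2 using hs s h2
  rw [map_sub, E.energy_comm g f] at h1
  linarith [E.energy_self_nonneg g]

theorem norm_le_of_incl_eq_posPart (E : DirichletForm μ) {f g : E.FormDomain}
    (h : E.incl g = (E.incl f)⁺) : ‖g‖ ≤ ‖f‖ := by
  refine le_of_sq_le_sq ?_ (norm_nonneg _)
  rw [norm_sq_eq, norm_sq_eq]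
  refine add_le_add (E.energy_le_of_incl_eq_posPart h) (pow_le_pow_left₀ (norm_nonneg _) ?_ 2)
  rw [h]
  refine Lp.norm_le_norm_of_ae_le ?_
  filter_upwards [Lp_coeFn_posPart (E.incl f)] with x hx
  rw [hx, Real.norm_eq_abs, Real.norm_eq_abs, abs_of_nonneg (le_max_right _ _)]
  exact max_le (le_abs_self _) (abs_nonneg _)

end DirichletForm

/-! ### Extension of functions from a set of full measure in a time interval -/

section Extension

theorem Icc_subset_closure_inter_Ioo {T : ℝ} (hT : 0 < T) {S : Set ℝ} (hS : ∀ᵐ t, t ∈ S) :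
    Icc 0 T ⊆ closure (Ioo 0 T ∩ S) := by
  rw [← closure_Ioo hT.ne]
  exact closure_minimal ((Measure.dense_of_ae hS).open_subset_closure_inter isOpen_Ioo)
    isClosed_closure

/-- A function whose increments on a set of full measure are controlled by those of a continuous
function extends to a continuous function on the closed interval, both endpoints included. -/
theorem exists_continuousOn_extension {F : Type*} [NormedAddCommGroup F] [CompleteSpace F]
    {T : ℝ} (hT : 0 < T) {S : Set ℝ} (hS : ∀ᵐ t, t ∈ S) {f : ℝ → F} {M : ℝ → ℝ}
    (hM : Continuous M)
    (hf : ∀ s ∈ S, ∀ t ∈ S, 0 < s → s < t → t < T → ‖f t - f s‖ ^ 2 ≤ M t - M s) :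
    ∃ w : ℝ → F, ContinuousOn w (Icc 0 T) ∧ ∀ t ∈ Ioo 0 T ∩ S, w t = f t := by
  set A := Ioo 0 T ∩ S
  have hcl : Icc 0 T ⊆ closure A := Icc_subset_closure_inter_Ioo hT hS
  have hf' : ∀ s ∈ A, ∀ t ∈ A, ‖f t - f s‖ ^ 2 ≤ |M t - M s| := by
    intro s hs t ht
    rcases lt_trichotomy s t with h | h | h
    · exact (hf s hs.2 t ht.2 hs.1.1 h ht.1.2).trans (le_abs_self _)
    · simp [h]
    · rw [norm_sub_rev, abs_sub_comm]
      exact (hf t ht.2 s hs.2 ht.1.1 h hs.1.2).trans (le_abs_self _)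
  have hlim : ∀ x ∈ Icc 0 T, ∃ y, Tendsto f (𝓝[A] x) (𝓝 y) := by
    intro x hx
    have : (𝓝[A] x).NeBot := mem_closure_iff_nhdsWithin_neBot.1 (hcl hx)
    refine cauchy_map_iff_exists_tendsto.1 (Metric.cauchy_iff.2 ⟨map_neBot, fun ε hε => ?_⟩)
    obtain ⟨δ, hδ, hMδ⟩ := Metric.continuous_iff.1 hM x (ε ^ 2 / 2) (by positivity)
    refine ⟨f '' (A ∩ Metric.ball x δ), image_mem_map
      (inter_mem self_mem_nhdsWithin (mem_nhdsWithin_of_mem_nhds (Metric.ball_mem_nhds x hδ))), ?_⟩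
    rintro _ ⟨s, hs, rfl⟩ _ ⟨t, ht, rfl⟩
    have h1 := hMδ s hs.2
    have h2 := hMδ t ht.2
    rw [Real.dist_eq] at h1 h2
    rw [dist_eq_norm]
    refine lt_of_pow_lt_pow_left₀ 2 hε.le ((hf' t ht.1 s hs.1).trans_lt ?_)
    calc |M s - M t| = |(M s - M x) - (M t - M x)| := by congr 1; ring
      _ ≤ |M s - M x| + |M t - M x| := abs_sub _ _
      _ < ε ^ 2 := by linarith
  refine ⟨extendFrom A f, continuousOn_extendFrom hcl hlim, fun t ht => ?_⟩
  obtain ⟨y, hy⟩ := hlim t (Ioo_subset_Icc_self ht.1)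
  have hne : (𝓝[A] t).NeBot := mem_closure_iff_nhdsWithin_neBot.1 (subset_closure ht)
  rw [extendFrom_eq (subset_closure ht) hy]
  have : Tendsto f (pure t) (𝓝 y) := hy.mono_left (pure_le_nhdsWithin ht)
  exact (tendsto_nhds_unique this (tendsto_pure_nhds f t))

theorem exists_integrable_extension {F : Type*} [NormedAddCommGroup F] {T : ℝ} {f : ℝ → F}
    (hf : MemLp f 2 (volume.restrict (Icc 0 T))) :
    ∃ f₀ : ℝ → F, (∀ t ∈ Icc 0 T, f₀ t = f t) ∧ (∀ t, t ∉ Icc 0 T → f₀ t = 0) ∧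
      MemLp f₀ 2 volume ∧ Integrable f₀ := by
  have h : IntegrableOn f (Icc 0 T) := hf.integrable one_le_two
  exact ⟨(Icc 0 T).indicator f, fun t ht => indicator_of_mem ht f,
    fun t ht => indicator_of_notMem ht f, (memLp_indicator_iff_restrict measurableSet_Icc).2 hf,
    h.integrable_indicator measurableSet_Icc⟩

theorem setIntegral_smul_eq_integral {F : Type*} [NormedAddCommGroup F] [NormedSpace ℝ F]
    {s : Set ℝ} (hs : MeasurableSet s) {f f₀ : ℝ → F} (h1 : ∀ t ∈ s, f₀ t = f t)
    (h0 : ∀ t, t ∉ s → f₀ t = 0) (χ : ℝ → ℝ) : ∫ t in s, χ t • f t = ∫ t, χ t • f₀ t := by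
  have h : ∫ t in s, χ t • f₀ t = ∫ t, χ t • f₀ t :=
    setIntegral_eq_integral_of_forall_compl_eq_zero fun t ht => by rw [h0 t ht, smul_zero]
  rw [← h]
  exact setIntegral_congr_fun hs fun t ht => by simp only [h1 t ht]

end Extension

/-! ### Energy estimates in a Gelfand triple

The triple `H ⊂ L ⊂ H*` is given by a continuous linear map `ι : H → L`; an element `f` of `H` acts
on `H` by `z ↦ ⟪ι f, ι z⟫`. -/

section GelfandTriple

variable {H L : Type*} [NormedAddCommGroup H] [InnerProductSpace ℝ H]
  [NormedAddCommGroup L] [InnerProductSpace ℝ L] {ι : H →L[ℝ] L}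

/-- A curve with weak derivative `u'` in `L²([0, T]; H*)` is, as a curve in `H*` and outside a null
set of times, a primitive of `u'`. -/
theorem exists_inner_sub_eq {T : ℝ} {u : ℝ → H} {u' : ℝ → StrongDual ℝ H}
    (hu : MemLp u 2 (volume.restrict (Icc 0 T))) (hu' : MemLp u' 2 (volume.restrict (Icc 0 T)))
    (hweak : ∀ χ : ℝ → ℝ, ContDiff ℝ ∞ χ → HasCompactSupport χ → tsupport χ ⊆ Ioo 0 T →
      ∫ t in Icc 0 T, χ t • u' t
        = - ∫ t in Icc 0 T, deriv χ t • (innerSL ℝ (ι (u t))).comp ι) :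
    ∃ S : Set ℝ, (∀ᵐ t, t ∈ S) ∧ ∀ s ∈ S, ∀ t ∈ S, 0 < s → s < t → t < T → ∀ z : H,
      inner ℝ (ι (u t) - ι (u s)) (ι z) = ∫ r in s..t, u' r z := by
  let LL : H →L[ℝ] StrongDual ℝ H :=
    { toFun := fun f => (innerSL ℝ (ι f)).comp ι
      map_add' := fun f g => by ext z; simp
      map_smul' := fun c f => by ext z; simp
      cont := by fun_prop }
  obtain ⟨f₀, hf₀, hf₀', -, hf1⟩ := exists_integrable_extension (LL.comp_memLp' hu)
  obtain ⟨g, hg, hg', -, hg1⟩ := exists_integrable_extension hu'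
  obtain ⟨S, hS, hS2⟩ := exists_sub_eq_integral_of_weakDeriv (T := T) hf1 hg1 fun χ c1 c2 c3 => by
    rw [← setIntegral_smul_eq_integral measurableSet_Icc hg hg',
      ← setIntegral_smul_eq_integral measurableSet_Icc hf₀ hf₀']
    exact hweak χ c1 c2 c3
  refine ⟨S, hS, fun s hs t ht h0 hst htT z => ?_⟩
  have hsm : s ∈ Icc 0 T := ⟨h0.le, (hst.trans htT).le⟩
  have htm : t ∈ Icc 0 T := ⟨(h0.trans hst).le, htT.le⟩
  have e := congrArg (fun ℓ : StrongDual ℝ H => ℓ z) (hS2 s hs t ht h0 hst htT)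
  simp only [hf₀ s hsm, hf₀ t htm] at e
  rw [ContinuousLinearMap.intervalIntegral_apply hg1.intervalIntegrable] at e
  rw [inner_sub_left]
  refine Eq.trans e (intervalIntegral.integral_congr fun r hr => ?_)
  rw [uIcc_of_le hst.le] at hr
  simp only [hg r ⟨h0.le.trans hr.1, hr.2.trans htT.le⟩]

/-- One-sided chain rule. Suppose that `N t = Φ (ι (u t))` for a convex function `Φ`, and that
`ι (v t)` is a subgradient of `Φ` at `ι (u t)`. Then, between Lebesgue points of `N`, the increment
of `N` is at most the integral of the pairing of `u'` with `v`. Convexity bounds the increment of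
`N` from above by pairing that of `u` with the subgradient at the later time (`σ = 1`); `σ = 0`
serves concave `Φ`. -/
theorem sub_le_integral_of_subgradient {T σ : ℝ} {u v : ℝ → H}
    {g : ℝ → StrongDual ℝ H} {N : ℝ → ℝ} {S : Set ℝ}
    (hg1 : Integrable g) (hv1 : Integrable v)
    (hg : MemLp g 2 volume) (hv : MemLp v 2 volume) (hN : Integrable N) (hS : ∀ᵐ t, t ∈ S)
    (hinc : ∀ s ∈ S, ∀ t ∈ S, 0 < s → s < t → t < T → ∀ z : H,
      inner ℝ (ι (u t) - ι (u s)) (ι z) = ∫ r in s..t, g r z)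
    (hsub : ∀ s ∈ S, ∀ t ∈ S,
      N t - N s ≤ inner ℝ (ι (u t) - ι (u s)) (ι (v (s + σ * (t - s)))))
    {a b : ℝ} (ha : 0 < a) (hab : a ≤ b) (hb : b < T)
    (hNa : HasDerivAt (fun x => ∫ t in 0..x, N t) (N a) a)
    (hNb : HasDerivAt (fun x => ∫ t in 0..x, N t) (N b) b) :
    N b - N a ≤ ∫ t in a..b, g t (v t) := by
  refine sub_le_integral_of_increment_le (σ := σ) hg1 hv1 hg hv hN (fun h hh => ?_) ha hab hb
    hNa hNb
  filter_upwards [hS, (measurePreserving_add_right volume h).quasiMeasurePreserving.ae hS]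
    with t h1 h2 h0 hT
  have h3 := hsub t h1 (t + h) h2
  rw [hinc t h1 (t + h) h2 h0 (by linarith) hT, add_sub_cancel_left] at h3
  rwa [intervalIntegral.integral_comp_add_left (fun r => g r (v (t + σ * h))) t, add_zero]

theorem integrable_dual_apply {v : ℝ → H}
    {g : ℝ → StrongDual ℝ H} {ν : Measure ℝ} (hg : MemLp g 2 ν) (hv : MemLp v 2 ν) :
    Integrable (fun t => g t (v t)) ν := by
  refine (hg.norm.integrable_mul hv.norm).mono' ?_ (ae_of_all _ fun t => (g t).le_opNorm _)
  exact (ContinuousLinearMap.id ℝ (StrongDual ℝ H)).aestronglyMeasurable_comp₂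
    hg.aestronglyMeasurable hv.aestronglyMeasurable

theorem integrable_half_norm_sq {F : Type*} [NormedAddCommGroup F] {f : ℝ → F}
    (hf : MemLp f 2 volume) : Integrable fun t => ‖f t‖ ^ 2 / 2 :=
  (hf.integrable_norm_pow two_ne_zero).div_const 2

/-- Modulus of continuity in `L` of a curve in `L²([0, T]; H)` with derivative in `L²([0, T]; H*)`.
The energy identity `‖ι (u q)‖² - ‖ι (u p)‖² = 2 ∫ ⟨u', u⟩`, applied to `u - c` with `c` a value of
`u` at an endpoint, bounds `‖ι (u q) - ι (u p)‖²` in terms of `‖c‖`. The norm of `c` in `H` is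
controlled by comparing `u s` and `u t` with the value at an intermediate time where `‖u‖²` does
not exceed its average over `(s, t)`. -/
theorem norm_incl_sub_sq_le {T : ℝ} {u : ℝ → H}
    {g : ℝ → StrongDual ℝ H} {S : Set ℝ}
    (hg1 : Integrable g) (hu1 : Integrable u)
    (hg : MemLp g 2 volume) (hu : MemLp u 2 volume) (hS : ∀ᵐ t, t ∈ S)
    (hinc : ∀ s ∈ S, ∀ t ∈ S, 0 < s → s < t → t < T → ∀ z : H,
      inner ℝ (ι (u t) - ι (u s)) (ι z) = ∫ r in s..t, g r z)
    (hder : ∀ t ∈ S, HasDerivAt (fun x => ∫ r in 0..x, ‖ι (u r)‖ ^ 2 / 2)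
      (‖ι (u t)‖ ^ 2 / 2) t) :
    ∀ s ∈ S, ∀ t ∈ S, 0 < s → s < t → t < T →
      ‖ι (u t) - ι (u s)‖ ^ 2 ≤ 8 * ∫ r in s..t, (‖g r‖ ^ 2 + ‖u r‖ ^ 2) := by
  set N : ℝ → ℝ := fun r => ‖ι (u r)‖ ^ 2 / 2 with hNdef
  have hN : Integrable N := integrable_half_norm_sq (ι.comp_memLp' hu)
  -- the energy identity: both inequalities are instances of the one-sided chain rule
  have hen : ∀ p ∈ S, ∀ q ∈ S, 0 < p → p < q → q < T → N q - N p = ∫ r in p..q, g r (u r) := by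
    intro p hp q hq h0 hpq hqT
    refine le_antisymm ?_ ?_
    · refine sub_le_integral_of_subgradient (σ := 1) hg1 hu1 hg hu hN hS hinc
        (fun s hs t ht => ?_) h0 hpq.le hqT (hder p hp) (hder q hq)
      rw [one_mul, add_sub_cancel, inner_sub_left, real_inner_self_eq_norm_sq]
      have h1 := real_inner_le_norm (ι (u s)) (ι (u t))
      simp only [N]
      nlinarith [sq_nonneg (‖ι (u t)‖ - ‖ι (u s)‖)]
    · have hneg : ∀ x ∈ S, HasDerivAt (fun x => ∫ r in 0..x, -N r) (-N x) x := by
        intro x hx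
        simp_rw [intervalIntegral.integral_neg]
        exact (hder x hx).neg
      have h := sub_le_integral_of_subgradient (σ := 0) (v := fun t => -u t) (N := fun t => -N t)
        hg1 hu1.neg hg hu.neg hN.neg hS hinc (fun s hs t ht => ?_) h0 hpq.le hqT
        (hneg p hp) (hneg q hq)
      · simp only [map_neg, intervalIntegral.integral_neg] at h
        linarith
      · rw [zero_mul, add_zero, map_neg, inner_neg_right, inner_sub_left,
          real_inner_self_eq_norm_sq]
        have h1 := real_inner_le_norm (ι (u t)) (ι (u s))
        simp only [N]
        nlinarith [sq_nonneg (‖ι (u t)‖ - ‖ι (u s)‖)]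
  have hgu : Integrable fun r => g r (u r) := integrable_dual_apply hg hu
  have hgc : ∀ c, Integrable fun r => g r c := fun c => hg1.apply_continuousLinearMap c
  have hg2 : Integrable fun r => ‖g r‖ ^ 2 := hg.integrable_norm_pow two_ne_zero
  have hu2 : Integrable fun r => ‖u r‖ ^ 2 := hu.integrable_norm_pow two_ne_zero
  -- the distance to a value `c` attained at an endpoint
  have hbound : ∀ c p q, p ≤ q → |∫ r in p..q, (g r (u r) - g r c)|
      ≤ (∫ r in p..q, (‖g r‖ ^ 2 + ‖u r‖ ^ 2 / 2)) + (q - p) * (‖c‖ ^ 2 / 2) := by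
    intro c p q hpq
    have e : (q - p) * (‖c‖ ^ 2 / 2) = ∫ r in p..q, ‖c‖ ^ 2 / 2 := by
      rw [intervalIntegral.integral_const, smul_eq_mul]
    have i1 : IntervalIntegrable (fun r => ‖g r‖ ^ 2 + ‖u r‖ ^ 2 / 2) volume p q :=
      (hg2.add (hu2.div_const 2)).intervalIntegrable
    rw [e, ← intervalIntegral.integral_add i1 (by simp)]
    refine (intervalIntegral.abs_integral_le_integral_abs hpq).trans ?_
    refine intervalIntegral.integral_mono_on hpq (hgu.sub (hgc c)).abs.intervalIntegrable
      (i1.add (by simp)) fun r _ => ?_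
    have h1 := (g r).le_opNorm (u r)
    have h2 := (g r).le_opNorm c
    rw [Real.norm_eq_abs] at h1 h2
    refine (abs_sub _ _).trans ?_
    nlinarith [sq_nonneg (‖g r‖ - ‖u r‖), sq_nonneg (‖g r‖ - ‖c‖)]
  have hdist : ∀ p ∈ S, ∀ q ∈ S, 0 < p → p < q → q < T → ∀ c, (c = u p ∨ c = u q) →
      ‖ι (u q) - ι (u p)‖ ^ 2 / 2
        ≤ (∫ r in p..q, (‖g r‖ ^ 2 + ‖u r‖ ^ 2 / 2)) + (q - p) * (‖c‖ ^ 2 / 2) := by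
    intro p hp q hq h0 hpq hqT c hc
    refine le_trans ?_ (hbound c p q hpq.le)
    rw [intervalIntegral.integral_sub hgu.intervalIntegrable (hgc c).intervalIntegrable,
      ← hen p hp q hq h0 hpq hqT, ← hinc p hp q hq h0 hpq hqT c]
    have h1 := norm_sub_sq_real (ι (u q)) (ι (u p))
    rcases hc with rfl | rfl
    · refine le_trans (le_of_eq ?_) (le_abs_self _)
      rw [inner_sub_left, real_inner_self_eq_norm_sq, h1]
      ring
    · refine le_trans (le_of_eq ?_) (neg_le_abs _)
      rw [inner_sub_left, real_inner_self_eq_norm_sq, h1, real_inner_comm]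
      ring
  intro s hs t ht h0 hst htT
  -- an intermediate time at which `‖u‖²` is at most its average over `(s, t)`
  obtain ⟨m, hmN, hm⟩ := exists_notMem_null_le_average (μ := volume.restrict (Ioo s t))
    (N := (Ioo s t ∩ S)ᶜ) (by simp [Measure.restrict_eq_zero, hst])
    (hu2.restrict (s := Ioo s t)) (by
      rw [← mem_ae_iff]
      exact inter_mem (ae_restrict_mem measurableSet_Ioo) (ae_restrict_of_ae hS))
  obtain ⟨hm1, hm2⟩ := not_not.1 hmN
  have hmavg : (t - s) * ‖u m‖ ^ 2 ≤ ∫ r in s..t, ‖u r‖ ^ 2 := by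
    rw [setAverage_eq, Measure.real, Real.volume_Ioo, ENNReal.toReal_ofReal (sub_pos.2 hst).le,
      smul_eq_mul] at hm
    rw [intervalIntegral.integral_of_le hst.le, integral_Ioc_eq_integral_Ioo]
    calc _ ≤ (t - s) * ((t - s)⁻¹ * ∫ r in Ioo s t, ‖u r‖ ^ 2) :=
          mul_le_mul_of_nonneg_left hm (sub_pos.2 hst).le
      _ = _ := mul_inv_cancel_left₀ (sub_pos.2 hst).ne' _
  have d1 := hdist s hs m hm2 h0 hm1.1 (hm1.2.trans htT) (u m) (Or.inr rfl)
  have d2 := hdist m hm2 t ht (h0.trans hm1.1) hm1.2 htT (u m) (Or.inl rfl)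
  have i1 : ∀ p q, IntervalIntegrable (fun r => ‖g r‖ ^ 2 + ‖u r‖ ^ 2 / 2) volume p q :=
    fun p q => (hg2.add (hu2.div_const 2)).intervalIntegrable
  have e1 := intervalIntegral.integral_add_adjacent_intervals (i1 s m) (i1 m t)
  have e2 : ∫ r in s..t, (‖g r‖ ^ 2 + ‖u r‖ ^ 2 / 2)
      = (∫ r in s..t, ‖g r‖ ^ 2) + (∫ r in s..t, ‖u r‖ ^ 2) / 2 := by
    rw [intervalIntegral.integral_add hg2.intervalIntegrable
      (hu2.div_const 2).intervalIntegrable, intervalIntegral.integral_div]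
  have e3 : ∫ r in s..t, (‖g r‖ ^ 2 + ‖u r‖ ^ 2)
      = (∫ r in s..t, ‖g r‖ ^ 2) + ∫ r in s..t, ‖u r‖ ^ 2 :=
    intervalIntegral.integral_add hg2.intervalIntegrable hu2.intervalIntegrable
  have htri : ‖ι (u t) - ι (u s)‖ ^ 2 ≤ 2 * ‖ι (u t) - ι (u m)‖ ^ 2
      + 2 * ‖ι (u m) - ι (u s)‖ ^ 2 := by
    have h1 := norm_sub_le_norm_sub_add_norm_sub (ι (u t)) (ι (u m)) (ι (u s))
    nlinarith [sq_nonneg (‖ι (u t) - ι (u m)‖ - ‖ι (u m) - ι (u s)‖),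
      norm_nonneg (ι (u t) - ι (u s))]
  have hgn : 0 ≤ ∫ r in s..t, ‖g r‖ ^ 2 :=
    intervalIntegral.integral_nonneg hst.le fun r _ => sq_nonneg _
  have hun : 0 ≤ ∫ r in s..t, ‖u r‖ ^ 2 :=
    intervalIntegral.integral_nonneg hst.le fun r _ => sq_nonneg _
  rw [e3]
  linarith

end GelfandTriple

/-! ### Measurability and integrability in the form domain -/

namespace DirichletForm

variable {X : Type*} [MeasurableSpace X] {μ : Measure X}

theorem secondCountableTopology_formDomain (E : DirichletForm μ)
    [TopologicalSpace.SeparableSpace (Lp ℝ 2 μ)] : SecondCountableTopology E.FormDomain := by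
  have : TopologicalSpace.SeparableSpace E.FormDomain :=
    E.denseRange_adjoint_incl.separableSpace (ContinuousLinearMap.continuous _)
  exact UniformSpace.secondCountable_of_separable _

/-- Measurability of a curve in `𝔻` may be checked in `L²(X, μ)`: since `𝔻` is Polish, the
inclusion is a measurable embedding by the Lusin–Souslin theorem. -/
theorem aestronglyMeasurable_of_incl (E : DirichletForm μ)
    [TopologicalSpace.SeparableSpace (Lp ℝ 2 μ)] {α : Type*} [MeasurableSpace α] {ν : Measure α}
    {φ : α → E.FormDomain} (h : AEStronglyMeasurable (fun a => E.incl (φ a)) ν) :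
    AEStronglyMeasurable φ ν := by
  have := E.secondCountableTopology_formDomain
  borelize E.FormDomain
  let m : MeasurableSpace (Lp ℝ 2 μ) := borel _
  have : BorelSpace (Lp ℝ 2 μ) := ⟨rfl⟩
  have he : MeasurableEmbedding E.incl := E.incl.continuous.measurableEmbedding E.incl_injective
  exact (he.aemeasurable_comp_iff.1 h.aemeasurable).aestronglyMeasurable

theorem integrable_energy {E : DirichletForm μ} {u v : ℝ → E.FormDomain} {ν : Measure ℝ}
    (hu : MemLp u 2 ν) (hv : MemLp v 2 ν) : Integrable (fun t => E.energy (u t) (v t)) ν := by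
  have h1 : Integrable (fun t => inner ℝ (u t) (v t)) ν :=
    (hu.norm.integrable_mul hv.norm).mono'
      (hu.aestronglyMeasurable.inner hv.aestronglyMeasurable)
      (ae_of_all _ fun t => norm_inner_le_norm _ _)
  have hu' := E.incl.comp_memLp' hu
  have hv' := E.incl.comp_memLp' hv
  have h2 : Integrable (fun t => inner ℝ (E.incl (u t)) (E.incl (v t))) ν :=
    (hu'.norm.integrable_mul hv'.norm).mono'
      (hu'.aestronglyMeasurable.inner hv'.aestronglyMeasurable)
      (ae_of_all _ fun t => norm_inner_le_norm _ _)
  refine (h1.sub h2).congr (ae_of_all _ fun t => ?_)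
  simp only [Pi.sub_apply, inner_def, incl_apply, add_sub_cancel_right]

end DirichletForm

/-! ### The parabolic maximum principle -/

namespace DirichletForm

variable {X : Type*} [MeasurableSpace X] {μ : Measure X}

theorem exists_isContinuousVersion {E : DirichletForm μ} {T : ℝ} (hT : 0 < T)
    {u u₀ : ℝ → E.FormDomain} (hu₀ : ∀ t ∈ Ioo 0 T, u₀ t = u t) {m : ℝ → ℝ} (hm : Integrable m)
    {S : Set ℝ} (hS : ∀ᵐ t, t ∈ S)
    (h : ∀ s ∈ S, ∀ t ∈ S, 0 < s → s < t → t < T →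
      ‖E.incl (u₀ t) - E.incl (u₀ s)‖ ^ 2 ≤ 8 * ∫ r in s..t, m r) :
    ∃ w, E.IsContinuousVersion T u w ∧ ∀ t ∈ Ioo 0 T ∩ S, w t = E.incl (u₀ t) := by
  have hi : ∀ a b, IntervalIntegrable m volume a b := fun a b => hm.intervalIntegrable
  have hM : Continuous fun t => 8 * ∫ r in 0..t, m r :=
    (intervalIntegral.continuous_primitive hi 0).const_mul 8
  obtain ⟨w, hw, hw2⟩ := exists_continuousOn_extension hT hS (f := fun t => E.incl (u₀ t)) hM
    fun s hs t ht h0 hst htT => by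
      rw [← mul_sub, intervalIntegral.integral_interval_sub_left (hi _ _) (hi _ _)]
      exact h s hs t ht h0 hst htT
  refine ⟨w, ⟨hw, ?_⟩, hw2⟩
  rw [← restrict_Ioo_eq_restrict_Icc]
  filter_upwards [ae_restrict_mem measurableSet_Ioo, ae_restrict_of_ae hS] with t h1 h2
  rw [hw2 t ⟨h1, h2⟩, hu₀ t h1]

variable [TopologicalSpace X]

theorem zero_mem_domainOn (E : DirichletForm μ) (U : Set X) : (0 : E.FormDomain) ∈ E.domainOn U := by
  refine subset_closure ⟨0, continuous_const, HasCompactSupport.zero, by simp [tsupport], ?_⟩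
  rw [map_zero]
  exact Lp.coeFn_zero ℝ 2 μ

/-- The maximum principle in the form `u(t)⁺ = 0`, for almost every `t`. Testing the equation with
`1_{(a, b]} u⁺` and using the one-sided chain rule for `‖u⁺‖² / 2` shows that this function does not
increase in time; its limit at time `0` vanishes. -/
theorem ae_posPart_eq_zero {E : DirichletForm μ} [TopologicalSpace.SeparableSpace (Lp ℝ 2 μ)]
    {U : Set X} {T : ℝ} (hT : 0 < T)
    {u : ℝ → E.FormDomain} {u' : ℝ → StrongDual ℝ E.FormDomain} (hu : E.IsW12 T u u')
    (hu0 : ∀ w : ℝ → Lp ℝ 2 μ, E.IsContinuousVersion T u w → w 0 ≤ 0)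
    (hpos : ∀ᵐ t ∂(volume.restrict (Icc 0 T)),
      ∃ g ∈ E.domainOn U, E.incl g = (E.incl (u t))⁺)
    (hweak : ∀ φ : ℝ → E.FormDomain, MemLp φ 2 (volume.restrict (Icc 0 T)) →
      (∀ᵐ t ∂(volume.restrict (Icc 0 T)), φ t ∈ E.domainOn U) →
      (∃ δ : ℝ, 0 < δ ∧
        ∀ᵐ t ∂(volume.restrict (Icc 0 T)), t ∉ Ioo δ (T - δ) → φ t = 0) →
      ∫ t in Icc 0 T, (u' t (φ t) + E.energy (u t) (φ t)) = 0) :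
    ∀ᵐ t ∂(volume.restrict (Icc 0 T)), (E.incl (u t))⁺ = 0 := by
  classical
  -- extension by zero to the whole time line
  obtain ⟨u₀, hu₀_eq, hu₀_zero, hu2, hu1⟩ := exists_integrable_extension hu.memLp
  obtain ⟨g, hg_eq, -, hg2, hg1⟩ := exists_integrable_extension
    (F := StrongDual ℝ E.FormDomain) hu.memLp_deriv
  -- the positive part as a curve in the form domain
  have hex : ∀ᵐ t, ∃ k ∈ E.domainOn U, E.incl k = (E.incl (u₀ t))⁺ := by
    filter_upwards [(ae_restrict_iff' measurableSet_Icc).1 hpos] with t ht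
    by_cases h : t ∈ Icc 0 T
    · rw [hu₀_eq t h]; exact ht h
    · exact ⟨0, E.zero_mem_domainOn U, by rw [hu₀_zero t h, map_zero, posPart_zero]⟩
  obtain ⟨v, hv⟩ : ∃ v : ℝ → E.FormDomain,
      ∀ᵐ t, v t ∈ E.domainOn U ∧ E.incl (v t) = (E.incl (u₀ t))⁺ := by
    refine ⟨fun t => if h : ∃ k ∈ E.domainOn U, E.incl k = (E.incl (u₀ t))⁺ then h.choose else 0, ?_⟩
    filter_upwards [hex] with t ht
    rw [dif_pos ht]
    exact ht.choose_spec
  have hιu2 : MemLp (fun t => E.incl (u₀ t)) 2 volume := E.incl.comp_memLp' hu2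
  have hcont : Continuous fun f : Lp ℝ 2 μ => f⁺ := continuous_posPart
  have hιp : AEStronglyMeasurable (fun t => (E.incl (u₀ t))⁺) volume :=
    hcont.comp_aestronglyMeasurable hιu2.aestronglyMeasurable
  have hvm : AEStronglyMeasurable v volume :=
    E.aestronglyMeasurable_of_incl (hιp.congr (hv.mono fun t h => h.2.symm))
  have hvle : ∀ᵐ t, ‖v t‖ ≤ ‖u₀ t‖ := hv.mono fun t h => E.norm_le_of_incl_eq_posPart h.2
  have hv2 : MemLp v 2 volume := hu2.of_le hvm hvle
  have hv1 : Integrable v := hu1.mono hvm hvle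
  have hp2 : MemLp (fun t => (E.incl (u₀ t))⁺) 2 volume :=
    (E.incl.comp_memLp' hv2).ae_eq (hv.mono fun t h => h.2)
  -- full-measure set of times where `u` is a primitive of `u'`, the curve `v` is the positive
  -- part of `u`, and both squared norms have a Lebesgue point
  obtain ⟨S₁, hS₁, hinc⟩ := exists_inner_sub_eq (ι := E.incl) hu.memLp hu.memLp_deriv hu.weak_deriv
  have hN1 := integrable_half_norm_sq hιu2
  have hN2 := integrable_half_norm_sq hp2
  obtain ⟨S, hSdef⟩ : ∃ S : Set ℝ, S = {t | t ∈ S₁ ∧ E.incl (v t) = (E.incl (u₀ t))⁺ ∧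
      (∀ c, HasDerivAt (fun x => ∫ r in c..x, ‖E.incl (u₀ r)‖ ^ 2 / 2)
        (‖E.incl (u₀ t)‖ ^ 2 / 2) t) ∧
      (∀ c, HasDerivAt (fun x => ∫ r in c..x, ‖(E.incl (u₀ r))⁺‖ ^ 2 / 2)
        (‖(E.incl (u₀ t))⁺‖ ^ 2 / 2) t)} := ⟨_, rfl⟩
  have hS : ∀ᵐ t, t ∈ S := by
    filter_upwards [hS₁, hv, LocallyIntegrable.ae_hasDerivAt_integral hN1.locallyIntegrable,
      LocallyIntegrable.ae_hasDerivAt_integral hN2.locallyIntegrable] with t h1 h2 h3 h4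
    rw [hSdef]
    exact ⟨h1, h2.2, h3, h4⟩
  have hSmem : ∀ t ∈ S, t ∈ S₁ ∧ E.incl (v t) = (E.incl (u₀ t))⁺ ∧
      (∀ c, HasDerivAt (fun x => ∫ r in c..x, ‖E.incl (u₀ r)‖ ^ 2 / 2)
        (‖E.incl (u₀ t)‖ ^ 2 / 2) t) ∧
      (∀ c, HasDerivAt (fun x => ∫ r in c..x, ‖(E.incl (u₀ r))⁺‖ ^ 2 / 2)
        (‖(E.incl (u₀ t))⁺‖ ^ 2 / 2) t) := by
    intro t ht
    rw [hSdef] at ht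
    exact ht
  have hinc' : ∀ s ∈ S, ∀ t ∈ S, 0 < s → s < t → t < T → ∀ z : E.FormDomain,
      inner ℝ (E.incl (u₀ t) - E.incl (u₀ s)) (E.incl z) = ∫ r in s..t, g r z := by
    intro s hs t ht h0 hst htT z
    rw [hu₀_eq t ⟨(h0.trans hst).le, htT.le⟩, hu₀_eq s ⟨h0.le, (hst.trans htT).le⟩]
    refine (hinc s (hSmem s hs).1 t (hSmem t ht).1 h0 hst htT z).trans
      (intervalIntegral.integral_congr fun r hr => ?_)
    rw [uIcc_of_le hst.le] at hr
    simp only [hg_eq r ⟨h0.le.trans hr.1, hr.2.trans htT.le⟩]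
  -- the continuous representative
  obtain ⟨w, hw, hwS⟩ := exists_isContinuousVersion hT
    (fun t ht => hu₀_eq t (Ioo_subset_Icc_self ht))
    ((hg2.integrable_norm_pow two_ne_zero).add (hu2.integrable_norm_pow two_ne_zero)) hS
    (norm_incl_sub_sq_le hg1 hu1 hg2 hu2 hS hinc' fun t ht => (hSmem t ht).2.2.1 0)
  have hw0 : (w 0)⁺ = 0 := posPart_eq_zero.2 (hu0 w hw)
  -- the norm of the positive part does not increase in time
  have hmono : ∀ a ∈ S, ∀ b ∈ S, 0 < a → a < b → b < T →
      ‖(E.incl (u₀ b))⁺‖ ^ 2 / 2 ≤ ‖(E.incl (u₀ a))⁺‖ ^ 2 / 2 := by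
    intro a ha b hb h0 hab hbT
    have h1 := sub_le_integral_of_subgradient (σ := 1) (ι := E.incl) hg1 hv1 hg2 hv2 hN2 hS hinc'
      (fun s hs t ht => by
        rw [one_mul, add_sub_cancel, (hSmem t ht).2.1, real_inner_comm]
        exact Lp_norm_posPart_sq_sub_le _ _) h0 hab.le hbT
      ((hSmem a ha).2.2.2 0) ((hSmem b hb).2.2.2 0)
    have h2 := hweak ((Ioc a b).indicator v) ?_ ?_ ?_
    · have hsub : Ioc a b ⊆ Icc 0 T := fun t ht => ⟨(h0.trans ht.1).le, ht.2.trans hbT.le⟩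
      have h3 : ∫ t in a..b, (g t (v t) + E.energy (u₀ t) (v t)) = 0 := by
        rw [intervalIntegral.integral_of_le hab.le, ← h2]
        trans ∫ t in Icc 0 T, (Ioc a b).indicator
          (fun t => g t (v t) + E.energy (u₀ t) (v t)) t
        · rw [setIntegral_indicator measurableSet_Ioc, inter_eq_right.2 hsub]
        · refine setIntegral_congr_fun measurableSet_Icc fun t ht => ?_
          by_cases h : t ∈ Ioc a b
          · simp only [indicator_of_mem h, hg_eq t ht, hu₀_eq t ht]
          · simp only [indicator_of_notMem h, map_zero, add_zero]
      have i1 : IntervalIntegrable (fun t => g t (v t)) volume a b :=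
        (integrable_dual_apply hg2 hv2).intervalIntegrable
      have i2 : IntervalIntegrable (fun t => E.energy (u₀ t) (v t)) volume a b :=
        (integrable_energy hu2 hv2).intervalIntegrable
      rw [intervalIntegral.integral_add i1 i2] at h3
      have h4 : 0 ≤ ∫ t in a..b, E.energy (u₀ t) (v t) :=
        intervalIntegral.integral_nonneg_of_ae hab.le
          (hv.mono fun t h => E.energy_posPart_nonneg h.2)
      linarith
    · exact (hv2.indicator measurableSet_Ioc).restrict _
    · refine ae_restrict_of_ae (hv.mono fun t h => ?_)
      by_cases ht : t ∈ Ioc a b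
      · rw [indicator_of_mem ht]; exact h.1
      · rw [indicator_of_notMem ht]; exact E.zero_mem_domainOn U
    · refine ⟨min a ((T - b) / 2), lt_min h0 (by linarith), ae_of_all _ fun t ht =>
        indicator_of_notMem (fun h => ht ⟨?_, ?_⟩) _⟩
      · exact (min_le_left _ _).trans_lt h.1
      · have := min_le_right a ((T - b) / 2)
        linarith [h.2]
  rw [← restrict_Ioo_eq_restrict_Icc]
  filter_upwards [ae_restrict_mem measurableSet_Ioo, ae_restrict_of_ae hS] with b hb hbS
  rw [← hu₀_eq b (Ioo_subset_Icc_self hb)]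
  have : (𝓝[Ioo 0 T ∩ S] (0 : ℝ)).NeBot :=
    mem_closure_iff_nhdsWithin_neBot.1 (Icc_subset_closure_inter_Ioo hT hS ⟨le_rfl, hT.le⟩)
  have hlim : Tendsto (fun a => ‖(w a)⁺‖ ^ 2 / 2) (𝓝[Ioo 0 T ∩ S] 0) (𝓝 (‖(w 0)⁺‖ ^ 2 / 2)) := by
    have h1 : Tendsto w (𝓝[Ioo 0 T ∩ S] 0) (𝓝 (w 0)) :=
      (hw.1 0 ⟨le_rfl, hT.le⟩).mono_left
        (nhdsWithin_mono _ (inter_subset_left.trans Ioo_subset_Icc_self))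
    exact ((((hcont.tendsto _).comp h1).norm).pow 2).div_const 2
  have hle : ‖(E.incl (u₀ b))⁺‖ ^ 2 / 2 ≤ ‖(w 0)⁺‖ ^ 2 / 2 := by
    refine ge_of_tendsto hlim ?_
    filter_upwards [self_mem_nhdsWithin, mem_nhdsWithin_of_mem_nhds (Iio_mem_nhds hb.1)]
      with a ha hab
    rw [hwS a ha]
    exact hmono a ha.2 b hbS ha.1.1 hab hb.2
  rw [hw0, norm_zero] at hle
  have h5 : ‖(E.incl (u₀ b))⁺‖ = 0 := by
    have := norm_nonneg ((E.incl (u₀ b))⁺)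
    nlinarith
  exact norm_eq_zero.1 h5

end DirichletForm

theorem theorem5p14 {X : Type*} [MetricSpace X] [TopologicalSpace.SeparableSpace X]
    [LocallyCompactSpace X] [MeasurableSpace X] [BorelSpace X]
    (μ : Measure X) [μ.Regular]
    (E : DirichletForm μ) (hreg : E.IsRegular) (hloc : E.IsStrictlyLocal)
    (U : Set X) (hU : IsOpen U) (T : ℝ) (hT : 0 < T)
    (u : ℝ → E.FormDomain) (u' : ℝ → StrongDual ℝ E.FormDomain) (hu : E.IsW12 T u u')
    -- `u(0) ≤ 0`, where `u(0)` is the value at `0` of the representative in `C([0,T]; L²)`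
    (hu0 : ∀ w : ℝ → Lp ℝ 2 μ, E.IsContinuousVersion T u w → w 0 ≤ 0)
    (hpos : ∀ᵐ t ∂(volume.restrict (Icc 0 T)),
      ∃ g ∈ E.domainOn U, E.incl g = (E.incl (u t))⁺)
    (hweak : ∀ φ : ℝ → E.FormDomain, MemLp φ 2 (volume.restrict (Icc 0 T)) →
      (∀ᵐ t ∂(volume.restrict (Icc 0 T)), φ t ∈ E.domainOn U) →
      (∃ δ : ℝ, 0 < δ ∧
        ∀ᵐ t ∂(volume.restrict (Icc 0 T)), t ∉ Ioo δ (T - δ) → φ t = 0) →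
      ∫ t in Icc 0 T, (u' t (φ t) + E.energy (u t) (φ t)) = 0) :
    (∀ᵐ t ∂(volume.restrict (Icc 0 T)), ∀ᵐ x ∂(μ.restrict U), E.incl (u t) x ≤ 0) ∧
    -- the same, for `u` as a function on `[0,T] × X`
    ∀ v : ℝ × X → ℝ, AEMeasurable v ((volume.restrict (Icc 0 T)).prod μ) →
      (∀ᵐ t ∂(volume.restrict (Icc 0 T)), (fun x => v (t, x)) =ᵐ[μ] E.incl (u t)) →
      ∀ᵐ p ∂((volume.restrict (Icc 0 T)).prod (μ.restrict U)), v p ≤ 0 := by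
  have : SecondCountableTopology X := UniformSpace.secondCountable_of_separable X
  have : Fact ((2 : ℝ≥0∞) ≠ ⊤) := ⟨ENNReal.ofNat_ne_top⟩
  have hmain := DirichletForm.ae_posPart_eq_zero hT hu hu0 hpos hweak
  have hle : ∀ᵐ t ∂(volume.restrict (Icc 0 T)), ∀ᵐ x ∂μ, E.incl (u t) x ≤ 0 := by
    filter_upwards [hmain] with t ht
    have h := Lp_coeFn_posPart (E.incl (u t))
    rw [ht] at h
    filter_upwards [h, Lp.coeFn_zero ℝ 2 μ] with x h1 h2
    rw [h2, Pi.zero_apply] at h1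
    exact max_eq_right_iff.1 h1.symm
  refine ⟨hle.mono fun t ht => ae_restrict_of_ae ht, fun v hv hvu => ?_⟩
  have hac : (volume.restrict (Icc 0 T)).prod (μ.restrict U) ≪ (volume.restrict (Icc 0 T)).prod μ :=
    Measure.AbsolutelyContinuous.rfl.prod Measure.restrict_le_self.absolutelyContinuous
  refine hac.ae_le ?_
  have hmk : ∀ᵐ p ∂((volume.restrict (Icc 0 T)).prod μ), hv.mk v p ≤ 0 := by
    rw [Measure.ae_prod_iff_ae_ae (measurableSet_le hv.measurable_mk measurable_const)]
    filter_upwards [Measure.ae_ae_of_ae_prod hv.ae_eq_mk, hvu, hle] with t h1 h2 h3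
    filter_upwards [h1, h2, h3] with x a b c
    rwa [← a, b]
  filter_upwards [hmk, hv.ae_eq_mk] with p h1 h2
  rwa [h2]
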